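/- **Setting.** Let $G=(V,E)$ be a finite connected simple graph whose vertices are called processes; $\mathcal N_p$ is the set of neighbours of $p$. For integers $\alpha,K\ge 1$ the incrementing system with parameters $(\alpha,K)$ is the set $\chi=\{-\alpha,\dots,0,\dots,K-1\}$ with the map $\varphi(x)=(x+1)\bmod K$ for $x\ge 0$ and $\varphi(x)=x+1$ for $x<0$; put $ring=\{0,\dots,K-1\}$, $tail=\{-\alpha,\dots,0\}$, $tail^*=tail\setminus\{0\}$. Fix an integer $\varrho\ge 1$ and two incrementing systems $(\chi_1,\varphi_1)$, $(\chi_2,\varphi_2)$ with parameters $(\alpha_1,K_1)$, $(\alpha_2,K_2)$. Each process $p$ has a master clock register $p.r_1\in\chi_1$ (clock $C_1$), a slave clock register $p.r_2\in\chi_2$ (clock $C_2$), and further application registers. For $i\in\{1,2\}$ define the predicates - $ConvergenceStep^i_p$: $p.r_i\in tail_i^*$ and, for all $q\in\mathcal N_p$, $q.r_i\in tail_i$ and $p.r_i\le q.r_i$; - $LocallyCorrect^i_p$: $p.r_i\in ring_i$ and, for all $q\in\mathcal N_p$, $q.r_i\in ring_i$ and ($p.r_i=q.r_i$ or $p.r_i=\varphi_i(q.r_i)$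 or $\varphi_i(p.r_i)=q.r_i$); - $NormalStep^i_p$: $p.r_i\in ring_i$ and, for all $q\in\mathcal N_p$, $p.r_i=q.r_i$ or $q.r_i=\varphi_i(p.r_i)$; - $ResetInit^i_p$: not $LocallyCorrect^i_p$, and $p.r_i\notin tail_i$. The **layer clock** is the protocol in which each process $p$ has the following guarded actions ($i\in\{1,2\}$), where $cond$, $cond_1$ are arbitrary predicates on configurations, and $CS_2$, $Initialization$, $Computation$ are arbitrary procedures writing only the application registers of $p$: - $NA$: guard $NormalStep^1_p\wedge LocallyCorrect^2_p$. Statement: if $p.r_1\equiv\varrho-1\pmod\varrho$ then { if $NormalStep^2_p\wedge cond$ then { $CS_2$; if $cond_1$ then $p.r_2:=\varphi_2(p.r_2)$ }; $Initialization$ } else $Computation$; finally $p.r_1:=\varphi_1(p.r_1)$. - $CA_i$: guard $ConvergenceStep^i_p$; statement $p.r_i:=\varphi_i(p.r_i)$. - $RA_i$: guard $ResetInit^i_p$; statement $p.r_i:=-\alpha_i$. In a step, an unfair distributed daemon chooses a nonempty set of enabled processes (processes with some action whose guard is true), and each of them atomically executes one of its enabled actions, evaluated in the current configuration. An execution is maximal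 if it is infinite or ends in a configuration in which no process is enabled. The layer clock is **stabilized** in a configuration if $WU=WU_1\cap WU_2$ holds there, where $WU_i$ means: every $p.r_i$ lies in $ring_i$, and for all neighbours $p,q$ the distance $\min\big((p.r_i-q.r_i)\bmod K_i,\ (q.r_i-p.r_i)\bmod K_i\big)$ is at most $1$. Let $C_G$ be the cyclomatic characteristic of $G$: the smallest length, over all cycle bases of $G$ (sets of cycles forming a basis of the cycle space over $\mathbb Z/2$), of the longest cycle in the basis, with the convention $C_G=2$ if $G$ is acyclic. Assume $K_1>C_G$. **Proposition (No starvation).** In every maximal execution $\gamma_0\gamma_1\cdots$ of the layer clock and for every time $T$ such that the layer clock is stabilized in $\gamma_T$, every process $p$ increments its master clock $C_1$ infinitely often after time $T$: there are infinitely many steps $\gamma_t\mapsto\gamma_{t+1}$ with $t\ge T$ in which the value of $p.r_1$ changes to $\varphi_1(p.r_1)$. (In particular, the execution is infinite.) -/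

import Mathlib

namespace WaveletClock

/-! ### Cycle bases and the cyclomatic characteristic of a graph -/

section CycleSpace

variable {V : Type*} (G : SimpleGraph V)

/-- `C` is the edge set of a (simple) cycle of `G`. -/
def IsCycleEdgeSet (C : Set (Sym2 V)) : Prop :=
  ∃ (v : V) (w : G.Walk v v), w.IsCycle ∧ w.edgeSet = C

open Classical in
/-- The indicator vector over `ℤ/2` of a set of edges. -/
noncomputable def edgeVector (C : Set (Sym2 V)) : Sym2 V → ZMod 2 :=
  fun e => if e ∈ C then 1 else 0

/-- The cycle space of `G` over `ℤ/2`: the span of the edge sets of its cycles. -/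
noncomputable def cycleSpace : Submodule (ZMod 2) (Sym2 V → ZMod 2) :=
  Submodule.span (ZMod 2) (edgeVector '' {C | IsCycleEdgeSet G C})

/-- A cycle basis of `G`: a set of cycles that is a basis of the cycle space. -/
structure IsCycleBasis (B : Set (Set (Sym2 V))) : Prop where
  isCycle : ∀ C ∈ B, IsCycleEdgeSet G C
  linearIndep : LinearIndepOn (ZMod 2) edgeVector B
  span_eq : Submodule.span (ZMod 2) (edgeVector '' B) = cycleSpace G

open Classical in
/-- The cyclomatic characteristic of a finite graph: the least possible length of a longest
cycle of a cycle basis. For acyclic graphs, which have no cycles at all, it is `2` by convention. -/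
noncomputable def cyclomaticCharacteristic : ℕ :=
  if G.IsAcyclic then 2
  else sInf {L : ℕ | ∃ B, IsCycleBasis G B ∧ IsGreatest (Set.ncard '' B) L}

end CycleSpace

/-! ### Finite incrementing systems -/

/-- The parameters of a finite incrementing system: values `-α, …, 0, …, K - 1`. -/
structure IncrementingSystem where
  α : ℕ
  K : ℕ
  α_pos : 0 < α
  K_pos : 0 < K

namespace IncrementingSystem

variable (S : IncrementingSystem)

/-- The set `{-α, …, 0, …, K - 1}` of clock values. -/
abbrev Val : Type := {x : ℤ // -(S.α : ℤ) ≤ x ∧ x ≤ (S.K : ℤ) - 1}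

/-- The increment: `x ↦ x + 1 mod K` on the ring, `x ↦ x + 1` on the negative values. -/
def φ (x : S.Val) : S.Val :=
  ⟨if 0 ≤ x.1 then (x.1 + 1) % (S.K : ℤ) else x.1 + 1, by
    have hα := S.α_pos
    have hK : (0 : ℤ) < S.K := by exact_mod_cast S.K_pos
    have h1 := Int.emod_nonneg (x.1 + 1) hK.ne'
    have h2 := Int.emod_lt_of_pos (x.1 + 1) hK
    have h3 := x.2
    split_ifs <;> constructor <;> omega⟩

/-- The value `-α` that is enforced by a reset. -/
def resetVal : S.Val :=
  ⟨-(S.α : ℤ), le_rfl, by have := S.K_pos; omega⟩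

/-- The distance on the torus `ℤ/K`. -/
def torusDist (a b : ℤ) : ℤ := min ((a - b) % (S.K : ℤ)) ((b - a) % (S.K : ℤ))

variable {S}

/-- The expected values `{0, …, K - 1}`. -/
def InRing (x : S.Val) : Prop := 0 ≤ x.1

/-- The values `{-α, …, 0}`. -/
def InTail (x : S.Val) : Prop := x.1 ≤ 0

/-- The values `{-α, …, -1}`. -/
def InTailStar (x : S.Val) : Prop := x.1 < 0

variable {V : Type*} (G : SimpleGraph V) (r : V → S.Val) (p : V)

/-! In the following predicates `r q` is the value of the clock register of the process `q`. -/

def ConvergenceStep : Prop :=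
  InTailStar (r p) ∧ ∀ q, G.Adj p q → InTail (r q) ∧ (r p).1 ≤ (r q).1

def LocallyCorrect : Prop :=
  InRing (r p) ∧ ∀ q, G.Adj p q →
    InRing (r q) ∧ (r p = r q ∨ r p = S.φ (r q) ∨ S.φ (r p) = r q)

def NormalStep : Prop :=
  InRing (r p) ∧ ∀ q, G.Adj p q → r p = r q ∨ r q = S.φ (r p)

def ResetInit : Prop :=
  ¬ LocallyCorrect G r p ∧ ¬ InTail (r p)

/-- The legitimate register values: all of them are in the ring, and those of neighbours are
at distance at most `1` on the torus. -/
def WU : Prop :=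
  ∀ p, InRing (r p) ∧ ∀ q, G.Adj p q → S.torusDist (r p).1 (r q).1 ≤ 1

end IncrementingSystem

/-! ### The layer clock -/

/-- The registers of a process: the master clock `r₁`, the slave clock `r₂`, and the registers
`app` of the application that is scheduled by the layer clock. -/
structure ProcState (S₁ S₂ : IncrementingSystem) (A : Type*) where
  r₁ : S₁.Val
  r₂ : S₂.Val
  app : A

/-- A layer clock for the processes `V`: the radius `ρ`, the two incrementing systems, and the
problem dependent predicates and procedures. The procedures write application registers only.
All of them may be different for different processes, and they get the whole configuration as an
argument; those that read only the registers of the process and of its neighbours are included. -/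
structure LayerClock (V : Type*) (A : Type*) where
  ρ : ℕ
  ρ_pos : 0 < ρ
  /-- the incrementing system of the master clock -/
  S₁ : IncrementingSystem
  /-- the incrementing system of the slave clock -/
  S₂ : IncrementingSystem
  cond : V → (V → ProcState S₁ S₂ A) → Prop
  cond₁ : V → (V → ProcState S₁ S₂ A) → Prop
  /-- new application registers after the critical section `CS 2` -/
  cs₂ : V → (V → ProcState S₁ S₂ A) → A
  initialization : V → (V → ProcState S₁ S₂ A) → A
  computation : V → (V → ProcState S₁ S₂ A) → A

inductive Action where
  | NA
  | CA₁
  | CA₂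
  | RA₁
  | RA₂

namespace LayerClock

variable {V A : Type*} (P : LayerClock V A) (G : SimpleGraph V)

/-- Configurations of the system. -/
abbrev Config : Type _ := V → ProcState P.S₁ P.S₂ A

variable {P}

/-- The values of the master clock registers. -/
def reg₁ (γ : P.Config) : V → P.S₁.Val := fun q => (γ q).r₁

/-- The values of the slave clock registers. -/
def reg₂ (γ : P.Config) : V → P.S₂.Val := fun q => (γ q).r₂

/-- Both clocks are stabilized. -/
def WU (γ : P.Config) : Prop :=
  IncrementingSystem.WU G (reg₁ γ) ∧ IncrementingSystem.WU G (reg₂ γ)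

/-- The guards of the actions of the process `p`. -/
def Guard (γ : P.Config) (p : V) : Action → Prop
  | .NA => IncrementingSystem.NormalStep G (reg₁ γ) p ∧
      IncrementingSystem.LocallyCorrect G (reg₂ γ) p
  | .CA₁ => IncrementingSystem.ConvergenceStep G (reg₁ γ) p
  | .CA₂ => IncrementingSystem.ConvergenceStep G (reg₂ γ) p
  | .RA₁ => IncrementingSystem.ResetInit G (reg₁ γ) p
  | .RA₂ => IncrementingSystem.ResetInit G (reg₂ γ) p

/-! The pieces of the statement of the action `NA` of the process `p`, as maps on configurations
that write only registers of `p`. -/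

open Classical in
noncomputable def setApp (γ : P.Config) (p : V) (a : A) : P.Config :=
  Function.update γ p { γ p with app := a }

open Classical in
noncomputable def incr₁ (γ : P.Config) (p : V) : P.Config :=
  Function.update γ p { γ p with r₁ := P.S₁.φ (γ p).r₁ }

open Classical in
noncomputable def incr₂ (γ : P.Config) (p : V) : P.Config :=
  Function.update γ p { γ p with r₂ := P.S₂.φ (γ p).r₂ }

open Classical in
/-- `NormalStep² ∧ cond → CS 2; if cond₁ then r₂ := φ₂ r₂`. -/
noncomputable def slaveBlock (γ : P.Config) (p : V) : P.Config :=
  if IncrementingSystem.NormalStep G (reg₂ γ) p ∧ P.cond p γ then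
    let γ' := setApp γ p (P.cs₂ p γ)
    if P.cond₁ p γ' then incr₂ γ' p else γ'
  else γ

open Classical in
/-- The statement of `NA`: if `r₁ ≡ ρ - 1 [ρ]` then the block of the slave clock followed by
`Initialization`, else `Computation`; and finally `r₁ := φ₁ r₁`. -/
noncomputable def normalAction (γ : P.Config) (p : V) : P.Config :=
  incr₁
    (if (γ p).r₁.1 ≡ (P.ρ : ℤ) - 1 [ZMOD (P.ρ : ℤ)] then
      let γ' := slaveBlock G γ p
      setApp γ' p (P.initialization p γ')
    else setApp γ p (P.computation p γ)) p

/-- The state of `p` after it has executed an action in the configuration `γ`. -/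
noncomputable def exec (γ : P.Config) (p : V) : Action → ProcState P.S₁ P.S₂ A
  | .NA => normalAction G γ p p
  | .CA₁ => { γ p with r₁ := P.S₁.φ (γ p).r₁ }
  | .CA₂ => { γ p with r₂ := P.S₂.φ (γ p).r₂ }
  | .RA₁ => { γ p with r₁ := P.S₁.resetVal }
  | .RA₂ => { γ p with r₂ := P.S₂.resetVal }

/-- Some action is enabled at `p`. -/
def Enabled (γ : P.Config) (p : V) : Prop := ∃ a, Guard G γ p a

/-- A step under the (unfair) distributed daemon: a nonempty set of enabled processes is
chosen, and each of them atomically executes one of its enabled actions. -/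
def Step (γ γ' : P.Config) : Prop :=
  ∃ m : V → Option Action, (∃ p, m p ≠ none) ∧
    ∀ p, match m p with
      | none => γ' p = γ p
      | some a => Guard G γ p a ∧ γ' p = exec G γ p a

/-- `γ 0, γ 1, …` is a maximal execution with `L` steps (`L = ⊤` if it is infinite): a finite
one can end only in a configuration where no process is enabled. For finite `L` the values
`γ t` with `t > L` are irrelevant. -/
structure IsMaximalExecution (γ : ℕ → P.Config) (L : ℕ∞) : Prop where
  step : ∀ t : ℕ, (t : ℕ∞) < L → Step G (γ t) (γ (t + 1))
  terminal : ∀ t : ℕ, (t : ℕ∞) = L → ∀ p, ¬ Enabled G (γ t) p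

/-- The process `p` increments its master clock in the step from `γ t` to `γ (t + 1)`. -/
def Increments₁ (γ : ℕ → P.Config) (t : ℕ) (p : V) : Prop :=
  (γ t p).r₁ ≠ (γ (t + 1) p).r₁ ∧ (γ (t + 1) p).r₁ = P.S₁.φ (γ t p).r₁

end LayerClock

end WaveletClock

namespace WaveletClock

section WalkSum

open SimpleGraph

variable {V M : Type*} [AddCommGroup M] {G : SimpleGraph V}

/-- The sum of a function of ordered pairs of vertices along a walk. -/
def walkSum (d : V → V → M) {u v : V} (w : G.Walk u v) : M :=
  (w.darts.map fun e => d e.fst e.snd).sum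

@[simp] theorem walkSum_nil (d : V → V → M) (u : V) :
    walkSum d (Walk.nil : G.Walk u u) = 0 := by
  simp [walkSum]

@[simp] theorem walkSum_cons (d : V → V → M) {u v w : V} (h : G.Adj u v) (p : G.Walk v w) :
    walkSum d (p.cons h) = d u v + walkSum d p := by
  simp [walkSum]

@[simp] theorem walkSum_append (d : V → V → M) {u v w : V} (p : G.Walk u v) (q : G.Walk v w) :
    walkSum d (p.append q) = walkSum d p + walkSum d q := by
  simp [walkSum]

theorem walkSum_reverse {d : V → V → M} (hd : ∀ u v, d v u = -d u v) {u v : V}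
    (p : G.Walk u v) : walkSum d p.reverse = -walkSum d p := by
  induction p with
  | nil => simp
  | @cons a b _ h p ih => simp [ih, hd a b, add_comm]

theorem walkSum_eq_sub {d : V → V → M} {h : V → M}
    (hd : ∀ u v, G.Adj u v → d u v = h v - h u) {u v : V} (p : G.Walk u v) :
    walkSum d p = h v - h u := by
  induction p with
  | nil => simp
  | cons a p ih => simp [ih, hd _ _ a]

/-- An antisymmetric function vanishes on closed walks if it vanishes on cycles. -/
theorem walkSum_closed_eq_zero {d : V → V → M} (hd : ∀ u v, d v u = -d u v)
    (hc : ∀ (v : V) (w : G.Walk v v), w.IsCycle → walkSum d w = 0) {v : V} (w : G.Walk v v) :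
    walkSum d w = 0 := by
  classical
  have key : ∀ {u v : V} (p : G.Walk u v), walkSum d p = walkSum d p.bypass := by
    intro u v p
    induction p with
    | nil => rfl
    | @cons u v x h p ih =>
      rw [Walk.bypass]
      split_ifs with hs
      · have h1 := congrArg (walkSum d) (p.bypass.take_spec hs)
        have hp : (p.bypass.takeUntil u hs).IsPath := p.bypass_isPath.takeUntil hs
        rw [walkSum_append] at h1
        have h2 : d u v + walkSum d (p.bypass.takeUntil u hs) = 0 := by
          by_cases he : s(u, v) ∈ (p.bypass.takeUntil u hs).edges
          · rw [hp.eq_adj_toWalk_of_mem_edges (by rwa [Sym2.eq_swap])]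
            simp [hd u v]
          · rw [← walkSum_cons d h]
            exact hc _ _ ((Walk.cons_isCycle_iff _ _).2 ⟨hp, he⟩)
        rw [walkSum_cons, ih, ← h1, ← add_assoc, h2, zero_add]
      · rw [walkSum_cons, walkSum_cons, ih]
  rw [key w, (Walk.isPath_iff_nil.1 w.bypass_isPath).eq_nil, walkSum_nil]

/-- On a connected graph, an antisymmetric function that vanishes on cycles is a difference. -/
theorem exists_potential (hG : G.Connected) {d : V → V → M} (hd : ∀ u v, d v u = -d u v)
    (hc : ∀ (v : V) (w : G.Walk v v), w.IsCycle → walkSum d w = 0) :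
    ∃ h : V → M, ∀ u v, G.Adj u v → d u v = h v - h u := by
  obtain ⟨r⟩ := hG.nonempty
  let w : ∀ v, G.Walk r v := fun v => (hG r v).some
  refine ⟨fun v => walkSum d (w v), fun u v huv => ?_⟩
  have h := walkSum_closed_eq_zero hd hc ((w u).append (Walk.cons huv (w v).reverse))
  rw [walkSum_append, walkSum_cons, walkSum_reverse hd] at h
  rw [eq_sub_iff_add_eq, ← sub_eq_zero, ← h]
  abel

theorem abs_walkSum_le {d : V → V → ℤ} (hd : ∀ u v, |d u v| ≤ 1) {u v : V} (w : G.Walk u v) :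
    |walkSum d w| ≤ w.length := by
  induction w with
  | nil => simp
  | @cons a b _ h p ih =>
    rw [walkSum_cons, Walk.length_cons]
    push_cast
    linarith [abs_add_le (d a b) (walkSum d p), hd a b]

theorem dvd_walkSum {d : V → V → ℤ} {K : ℤ} {r : V → ℤ}
    (hd : ∀ u v, G.Adj u v → K ∣ d u v - (r v - r u)) {u v : V} (w : G.Walk u v) :
    K ∣ walkSum d w - (r v - r u) := by
  induction w with
  | nil => simp
  | @cons a b c h p ih =>
    rw [walkSum_cons]
    convert! dvd_add (hd a b h) ih using 1
    ring

theorem walkSum_intCast (d : V → V → ℤ) {u v : V} (w : G.Walk u v) :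
    walkSum (fun a b => (d a b : ZMod 2)) w = ((walkSum d w : ℤ) : ZMod 2) := by
  induction w with
  | nil => simp
  | cons h p ih => simp [ih]

theorem ncard_edgeSet_of_isCycle {v : V} {w : G.Walk v v} (hw : w.IsCycle) :
    w.edgeSet.ncard = w.length := by
  classical
  rw [← Walk.coe_edges_toFinset, Set.ncard_coe_finset,
    List.toFinset_card_of_nodup hw.isTrail.edges_nodup, Walk.length_edges]

open Classical in
/-- The sum of a symmetric function over a trail, as the value of a linear form at the
indicator vector of the edge set of the trail. -/
theorem sum_mul_edgeVector [Fintype (Sym2 V)] (f : Sym2 V → ZMod 2) {u v : V} (w : G.Walk u v)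
    (hw : w.IsTrail) :
    ∑ e, f e * edgeVector w.edgeSet e = walkSum (fun a b => f s(a, b)) w := by
  have h1 : ∑ e, f e * edgeVector w.edgeSet e = ∑ e ∈ w.edges.toFinset, f e := by
    simp only [edgeVector, Walk.mem_edgeSet, mul_ite, mul_one, mul_zero, ← Finset.sum_filter]
    congr 1
    ext
    simp
  rw [h1, List.sum_toFinset _ hw.edges_nodup, walkSum, Walk.edges, List.map_map]
  rfl

/-- If the sums of an antisymmetric integral function over the cycles of a cycle basis vanish,
then its sums over all cycles are even. -/
theorem even_walkSum_of_basis [Finite V] {B : Set (Set (Sym2 V))} (hB : IsCycleBasis G B)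
    {d : V → V → ℤ} (hd : ∀ u v, d v u = -d u v)
    (h0 : ∀ (v : V) (w : G.Walk v v), w.IsCycle → w.edgeSet ∈ B → walkSum d w = 0)
    {v : V} {w : G.Walk v v} (hw : w.IsCycle) : ((walkSum d w : ℤ) : ZMod 2) = 0 := by
  classical
  have := Fintype.ofFinite (Sym2 V)
  let f : Sym2 V → ZMod 2 := Sym2.lift ⟨fun a b => (d a b : ZMod 2), fun a b => by
    simp [hd a b]⟩
  have hf : ∀ {u v : V} (w : G.Walk u v), w.IsTrail →
      ∑ e, f e * edgeVector w.edgeSet e = ((walkSum d w : ℤ) : ZMod 2) := by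
    intro u v w hw
    rw [sum_mul_edgeVector f w hw, ← walkSum_intCast]
    rfl
  let l : (Sym2 V → ZMod 2) →ₗ[ZMod 2] ZMod 2 := Fintype.linearCombination (ZMod 2) f
  have hl : ∀ x, l x = ∑ e, f e * x e := fun x => by
    simp [l, Fintype.linearCombination_apply, mul_comm]
  have hker : Submodule.span (ZMod 2) (edgeVector '' B) ≤ LinearMap.ker l := by
    rw [Submodule.span_le]
    rintro _ ⟨C, hC, rfl⟩
    obtain ⟨v, w, hw, rfl⟩ := hB.isCycle C hC
    rw [SetLike.mem_coe, LinearMap.mem_ker, hl, hf w hw.isTrail, h0 v w hw hC, Int.cast_zero]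
  rw [hB.span_eq] at hker
  have := hker (Submodule.subset_span ⟨w.edgeSet, ⟨v, w, hw, rfl⟩, rfl⟩)
  rwa [LinearMap.mem_ker, hl, hf w hw.isTrail] at this

/-- The cycles of a cycle basis over `ℤ/2` determine the integral antisymmetric functions that
vanish on all closed walks. -/
theorem walkSum_eq_zero_of_basis [Finite V] (hG : G.Connected) {B : Set (Set (Sym2 V))}
    (hB : IsCycleBasis G B) {d : V → V → ℤ} (hd : ∀ u v, d v u = -d u v)
    (h0 : ∀ (v : V) (w : G.Walk v v), w.IsCycle → w.edgeSet ∈ B → walkSum d w = 0)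
    {v : V} (w : G.Walk v v) : walkSum d w = 0 := by
  have key : ∀ (n : ℕ) (d : V → V → ℤ), (∀ u v, d v u = -d u v) →
      (∀ (v : V) (w : G.Walk v v), w.IsCycle → w.edgeSet ∈ B → walkSum d w = 0) →
      ∀ {v : V} (w : G.Walk v v), (2 : ℤ) ^ n ∣ walkSum d w := by
    intro n
    induction n with
    | zero => simp
    | succ n ih =>
      intro d hd h0 v w
      obtain ⟨h, hh⟩ := exists_potential hG (d := fun a b => (d a b : ZMod 2))
        (fun u v => by rw [hd u v]; push_cast; rfl)
        (fun _ _ hw => by rw [walkSum_intCast]; exact even_walkSum_of_basis hB hd h0 hw)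
      let h' : V → ℤ := fun v => (h v).val
      let d' : V → V → ℤ := fun a b => (d a b - (h' b - h' a)).tdiv 2
      have hd' : ∀ u v, G.Adj u v → d u v = (h' v - h' u) + 2 * d' u v := by
        intro u v huv
        have h2 : (2 : ℤ) ∣ d u v - (h' v - h' u) := by
          rw [← Nat.cast_ofNat, ← ZMod.intCast_zmod_eq_zero_iff_dvd]
          simp [h', hh u v huv]
        have := Int.mul_tdiv_cancel' h2
        simp only [d']
        omega
      have hs : ∀ {x y : V} (w : G.Walk x y),
          walkSum d w = (h' y - h' x) + 2 * walkSum d' w := by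
        intro x y w
        induction w with
        | nil => simp
        | cons a p ih =>
          rw [walkSum_cons, walkSum_cons, ih, hd' _ _ a]
          ring
      have hs0 : ∀ {x : V} (w : G.Walk x x), walkSum d w = 2 * walkSum d' w := by
        intro x w
        rw [hs w]
        ring
      rw [hs0 w, pow_succ']
      refine mul_dvd_mul_left _ (ih d' (fun u v => ?_) (fun v w hw hwB => ?_) w)
      · simp only [d']
        rw [← Int.neg_tdiv, hd u v]
        congr 1
        ring
      · have := h0 v w hw hwB
        rw [hs0 w] at this
        omega
  refine Int.eq_zero_of_abs_lt_dvd (key (walkSum d w).natAbs d hd h0 w) ?_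
  rw [Int.abs_eq_natAbs]
  exact_mod_cast Nat.lt_two_pow_self

end WalkSum

section CyclomaticCharacteristic

open SimpleGraph

variable {V : Type*} {G : SimpleGraph V}

theorem exists_isCycleBasis (G : SimpleGraph V) : ∃ B, IsCycleBasis G B := by
  have h := linearIndepOn_empty (ZMod 2) (edgeVector (V := V))
  have ht : ∅ ⊆ {C | IsCycleEdgeSet G C} := Set.empty_subset _
  exact ⟨h.extend ht, fun C hC => h.extend_subset ht hC, h.linearIndepOn_extend ht,
    h.span_image_extend_eq_span_image ht⟩

theorem IsCycleBasis.nonempty {B : Set (Set (Sym2 V))} (hB : IsCycleBasis G B)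
    (hG : ¬ G.IsAcyclic) : B.Nonempty := by
  classical
  by_contra hne
  rw [Set.not_nonempty_iff_eq_empty] at hne
  simp only [IsAcyclic, not_forall, not_not] at hG
  obtain ⟨v, w, hw⟩ := hG
  have hmem : edgeVector w.edgeSet ∈ cycleSpace G :=
    Submodule.subset_span ⟨w.edgeSet, ⟨v, w, hw, rfl⟩, rfl⟩
  rw [← hB.span_eq, hne, Set.image_empty, Submodule.span_empty, Submodule.mem_bot] at hmem
  obtain ⟨e, he⟩ : ∃ e, e ∈ w.edges := by
    apply List.exists_mem_of_length_pos
    rw [Walk.length_edges]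
    have := hw.three_le_length
    omega
  have := congrFun hmem e
  simp [edgeVector, he] at this

/-- A graph that has a cycle has a cycle basis whose longest cycle has the length of the
cyclomatic characteristic. -/
theorem exists_basis_cyclomaticCharacteristic [Finite V] (hG : ¬ G.IsAcyclic) :
    ∃ B, IsCycleBasis G B ∧ IsGreatest (Set.ncard '' B) (cyclomaticCharacteristic G) := by
  rw [cyclomaticCharacteristic, if_neg hG]
  refine Nat.sInf_mem (s := {L : ℕ | ∃ B, IsCycleBasis G B ∧ IsGreatest (Set.ncard '' B) L}) ?_
  obtain ⟨B, hB⟩ := exists_isCycleBasis G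
  have hfin : (Set.ncard '' B).Finite := Set.toFinite _
  obtain ⟨L, hL, hmax⟩ := Set.exists_max_image _ id hfin ((hB.nonempty hG).image _)
  exact ⟨L, B, hB, hL, hmax⟩

theorem two_le_cyclomaticCharacteristic [Finite V] (G : SimpleGraph V) :
    2 ≤ cyclomaticCharacteristic G := by
  by_cases hG : G.IsAcyclic
  · rw [cyclomaticCharacteristic, if_pos hG]
  · obtain ⟨B, hB, ⟨C, hC, hL⟩, -⟩ := exists_basis_cyclomaticCharacteristic hG
    obtain ⟨v, w, hw, rfl⟩ := hB.isCycle C hC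
    rw [ncard_edgeSet_of_isCycle hw] at hL
    have := hw.three_le_length
    omega

/-- An antisymmetric function with values in `{-1, 0, 1}` whose sums over closed walks are
divisible by `K` vanishes on all cycles if `K` exceeds the cyclomatic characteristic. -/
theorem walkSum_eq_zero_of_cyclomaticCharacteristic_lt [Finite V] (hG : G.Connected) {K : ℕ}
    (hK : cyclomaticCharacteristic G < K) {d : V → V → ℤ} (hd : ∀ u v, d v u = -d u v)
    (hd1 : ∀ u v, |d u v| ≤ 1) (hdK : ∀ (v : V) (w : G.Walk v v), (K : ℤ) ∣ walkSum d w)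
    {v : V} {w : G.Walk v v} (hw : w.IsCycle) : walkSum d w = 0 := by
  have hGa : ¬ G.IsAcyclic := fun h => h w hw
  obtain ⟨B, hB, -, hmax⟩ := exists_basis_cyclomaticCharacteristic hGa
  refine walkSum_eq_zero_of_basis hG hB hd (fun v w hw hwB => ?_) w
  refine Int.eq_zero_of_abs_lt_dvd (hdK v w) ((abs_walkSum_le hd1 w).trans_lt ?_)
  rw [← ncard_edgeSet_of_isCycle hw]
  exact_mod_cast (hmax ⟨_, hwB, rfl⟩).trans_lt hK

end CyclomaticCharacteristic


namespace IncrementingSystem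

variable {S : IncrementingSystem}

theorem val_φ_of_inRing {x : S.Val} (hx : InRing x) :
    (S.φ x).1 = if x.1 + 1 = S.K then 0 else x.1 + 1 := by
  have h2 := x.2.2
  have h0 : 0 ≤ x.1 := hx
  simp only [φ, if_pos h0]
  split_ifs with h
  · rw [h, Int.emod_self]
  · exact Int.emod_eq_of_lt (by omega) (by omega)

theorem InRing.φ {x : S.Val} (hx : InRing x) : InRing (S.φ x) := by
  have h0 : 0 ≤ x.1 := hx
  unfold InRing
  rw [val_φ_of_inRing hx]
  split_ifs <;> omega

theorem dvd_val_φ_sub {x : S.Val} (hx : InRing x) : (S.K : ℤ) ∣ (S.φ x).1 - (x.1 + 1) := by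
  rw [val_φ_of_inRing hx]
  split_ifs with h
  · exact ⟨-1, by rw [h]; ring⟩
  · simp

theorem eq_of_dvd_sub {x y : S.Val} (hx : InRing x) (hy : InRing y)
    (h : (S.K : ℤ) ∣ x.1 - y.1) : x = y := by
  have hx0 : 0 ≤ x.1 := hx
  have hy0 : 0 ≤ y.1 := hy
  have := Int.eq_zero_of_abs_lt_dvd h (abs_lt.2 ⟨by linarith [y.2.2], by linarith [x.2.2]⟩)
  exact Subtype.ext (by omega)

theorem φ_ne_self (hK : 2 ≤ S.K) (x : S.Val) : S.φ x ≠ x := by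
  intro h
  have h' := congrArg Subtype.val h
  by_cases hx : 0 ≤ x.1
  · rw [val_φ_of_inRing hx] at h'
    split_ifs at h' <;> omega
  · simp [φ, hx] at h'

theorem sub_emod_of_inRing {x y : S.Val} (hx : InRing x) (hy : InRing y) :
    (x.1 - y.1) % (S.K : ℤ) = if y.1 ≤ x.1 then x.1 - y.1 else x.1 - y.1 + S.K := by
  have hx0 : 0 ≤ x.1 := hx
  have hy0 : 0 ≤ y.1 := hy
  have := x.2.2
  have := y.2.2
  split_ifs
  · exact Int.emod_eq_of_lt (by omega) (by omega)
  · rw [← Int.add_emod_right]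
    exact Int.emod_eq_of_lt (by omega) (by omega)

theorem torusDist_le_one_iff {x y : S.Val} (hx : InRing x) (hy : InRing y) :
    S.torusDist x.1 y.1 ≤ 1 ↔ x = y ∨ x = S.φ y ∨ S.φ x = y := by
  have hx0 : 0 ≤ x.1 := hx
  have hy0 : 0 ≤ y.1 := hy
  have := x.2.2
  have := y.2.2
  simp only [torusDist, min_le_iff, sub_emod_of_inRing hx hy, sub_emod_of_inRing hy hx,
    Subtype.ext_iff, val_φ_of_inRing hx, val_φ_of_inRing hy]
  split_ifs <;> omega

section Graph

variable {V : Type*} {G : SimpleGraph V} {r r' : V → S.Val}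

theorem wu_iff_forall_locallyCorrect : WU G r ↔ ∀ p, LocallyCorrect G r p := by
  refine ⟨fun h p => ⟨(h p).1, fun q hq => ⟨(h q).1, ?_⟩⟩,
    fun h p => ⟨(h p).1, fun q hq => ?_⟩⟩
  · exact (torusDist_le_one_iff (h p).1 (h q).1).1 ((h p).2 q hq)
  · exact (torusDist_le_one_iff (h p).1 (h q).1).2 ((h p).2 q hq).2

/-- The legitimate register values are preserved if some of the processes that can execute a
normal step increment their registers. -/
theorem WU.step (h : WU G r)
    (hr : ∀ p, r' p = r p ∨ (NormalStep G r p ∧ r' p = S.φ (r p))) : WU G r' := by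
  rw [wu_iff_forall_locallyCorrect] at h ⊢
  have hring : ∀ p, InRing (r' p) := fun p => by
    rcases hr p with h1 | ⟨-, h1⟩ <;> rw [h1]
    · exact (h p).1
    · exact (h p).1.φ
  refine fun p => ⟨hring p, fun q hpq => ⟨hring q, ?_⟩⟩
  rcases hr p with hp | ⟨hnp, hp⟩ <;> rcases hr q with hq | ⟨hnq, hq⟩ <;> rw [hp, hq]
  · exact ((h p).2 q hpq).2
  · rcases hnq.2 p hpq.symm with h1 | h1 <;> simp [h1]
  · rcases hnp.2 q hpq with h1 | h1 <;> simp [h1]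
  · rcases hnp.2 q hpq with h1 | h1 <;> simp [h1]

theorem LocallyCorrect.not_convergenceStep {p : V} (h : LocallyCorrect G r p) :
    ¬ ConvergenceStep G r p := fun h' => by
  have h1 : 0 ≤ (r p).1 := h.1
  have h2 : (r p).1 < 0 := h'.1
  omega

/-- The difference of the clocks of two processes, as an element of `{-1, 0, 1}`. -/
def delay (r : V → S.Val) (p q : V) : ℤ :=
  if r q = S.φ (r p) ∧ r p ≠ S.φ (r q) then 1
  else if r p = S.φ (r q) ∧ r q ≠ S.φ (r p) then -1 else 0

/-- A potential of the delays: an integral lift of the clocks that preserves the relation between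
neighbours. -/
structure IsLift (G : SimpleGraph V) (r : V → S.Val) (H : V → ℤ) : Prop where
  dvd : ∀ p, (S.K : ℤ) ∣ H p - (r p).1
  le : ∀ p q, G.Adj p q → H p ≤ H q + 1

theorem delay_swap (r : V → S.Val) (p q : V) : delay r q p = -delay r p q := by
  unfold delay
  split_ifs <;> first | rfl | tauto

theorem abs_delay_le_one (r : V → S.Val) (p q : V) : |delay r p q| ≤ 1 := by
  unfold delay
  split_ifs <;> simp

theorem φ_φ_ne_self (hK : 3 ≤ S.K) {x : S.Val} (hx : InRing x) : S.φ (S.φ x) ≠ x := by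
  intro h
  have h' := dvd_add (dvd_val_φ_sub hx.φ) (dvd_val_φ_sub hx)
  rw [h] at h'
  have h2 : (S.K : ℤ) ∣ 2 := by
    rw [← dvd_neg]
    convert! h' using 1
    ring
  have := Int.le_of_dvd (by norm_num) h2
  omega

theorem WU.dvd_delay_sub (hK : 3 ≤ S.K) (h : WU G r) {p q : V} (hpq : G.Adj p q) :
    (S.K : ℤ) ∣ delay r p q - ((r q).1 - (r p).1) := by
  have hne := φ_ne_self (S := S) (by omega)
  rcases ((wu_iff_forall_locallyCorrect.1 h p).2 q hpq).2 with h1 | h1 | h1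
  · simp [delay, h1]
  · have hφ := φ_φ_ne_self hK (h q).1
    rw [delay, if_neg (fun h' => h'.2 h1), if_pos ⟨h1, by rw [h1]; exact hφ.symm⟩, h1]
    convert! dvd_val_φ_sub (h q).1 using 1
    ring
  · have hφ := φ_φ_ne_self hK (h p).1
    rw [delay, if_pos ⟨h1.symm, by rw [← h1]; exact hφ.symm⟩, ← h1, ← dvd_neg]
    convert! dvd_val_φ_sub (h p).1 using 1
    ring

theorem WU.exists_isLift [Finite V] (hG : G.Connected) (hK : cyclomaticCharacteristic G < S.K)
    (h : WU G r) : ∃ H, IsLift G r H := by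
  have h3 : 3 ≤ S.K := (two_le_cyclomaticCharacteristic G).trans_lt hK
  have hdvd : ∀ u v, G.Adj u v → (S.K : ℤ) ∣ delay r u v - ((r v).1 - (r u).1) :=
    fun u v huv => h.dvd_delay_sub h3 huv
  obtain ⟨H, hH⟩ := exists_potential hG (delay_swap r) fun v w hw =>
    walkSum_eq_zero_of_cyclomaticCharacteristic_lt hG hK (delay_swap r) (abs_delay_le_one r)
      (fun v w => by simpa using dvd_walkSum (r := fun v => (r v).1) hdvd w) hw
  obtain ⟨v₀⟩ := hG.nonempty
  refine ⟨fun v => H v - H v₀ + (r v₀).1, fun p => ?_, fun p q hpq => ?_⟩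
  · have := dvd_walkSum (r := fun v => (r v).1) hdvd (hG v₀ p).some
    rw [walkSum_eq_sub hH] at this
    convert! this using 1
    ring
  · have := neg_le_of_abs_le (abs_delay_le_one r p q)
    rw [hH p q hpq] at this
    linarith

namespace IsLift

variable {H : V → ℤ}

/-- A process whose lifted clock is minimal among its neighbours can execute a normal step. -/
theorem normalStep (h : IsLift G r H) (hr : ∀ p, InRing (r p)) {p : V}
    (hp : ∀ q, G.Adj p q → H p ≤ H q) : NormalStep G r p := by
  refine ⟨hr p, fun q hpq => ?_⟩
  have hd := dvd_sub (h.dvd p) (h.dvd q)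
  have h1 := hp q hpq
  have h2 := h.le q p hpq.symm
  obtain h3 | h3 : H q = H p ∨ H q = H p + 1 := by omega
  · refine .inl (eq_of_dvd_sub (hr p) (hr q) ?_)
    rw [← dvd_neg]
    convert! hd using 1
    rw [h3]
    ring
  · refine .inr (eq_of_dvd_sub (hr q) (hr p).φ ?_)
    rw [← dvd_neg]
    convert! dvd_sub (dvd_val_φ_sub (hr p)) hd using 1
    rw [h3]
    ring

theorem le_of_normalStep (hK : 3 ≤ S.K) (h : IsLift G r H) {p q : V} (hp : NormalStep G r p)
    (hpq : G.Adj p q) : H p ≤ H q := by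
  by_contra! hlt
  have h1 := h.le p q hpq
  have h2 : H p = H q + 1 := by omega
  have hd := dvd_sub (h.dvd p) (h.dvd q)
  rw [h2] at hd
  rcases hp.2 q hpq with h3 | h3
  · have h4 : (S.K : ℤ) ∣ 1 := by
      convert! hd using 1
      rw [h3]
      ring
    have := Int.le_of_dvd (by norm_num) h4
    omega
  · have h4 : (S.K : ℤ) ∣ 2 := by
      convert! dvd_sub hd (dvd_val_φ_sub hp.1) using 1
      rw [h3]
      ring
    have := Int.le_of_dvd (by norm_num) h4
    omega

open Classical in
theorem step (hK : 3 ≤ S.K) (h : IsLift G r H)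
    (hr : ∀ p, r' p = r p ∨ (NormalStep G r p ∧ r' p = S.φ (r p))) :
    IsLift G r' fun p => H p + if r' p = r p then 0 else 1 := by
  refine ⟨fun p => ?_, fun p q hpq => ?_⟩
  · have hd := h.dvd p
    rcases hr p with h1 | ⟨hn, h1⟩
    · simpa [h1] using hd
    · simp only [h1, φ_ne_self (S := S) (by omega) (r p), if_false]
      convert! dvd_sub hd (dvd_val_φ_sub hn.1) using 1
      ring
  · have h1 := h.le p q hpq
    have h2 : r' p ≠ r p → H p ≤ H q := fun hne =>
      h.le_of_normalStep hK ((hr p).resolve_left hne).1 hpq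
    split_ifs with hp hq hq
    · omega
    · omega
    · have := h2 hp
      omega
    · omega

theorem le_add_length (h : IsLift G r H) {p q : V} (w : G.Walk p q) : H p ≤ H q + w.length := by
  induction w with
  | nil => simp
  | cons a w ih =>
    have := h.le _ _ a
    rw [SimpleGraph.Walk.length_cons]
    push_cast
    linarith

end IsLift

end Graph

end IncrementingSystem

namespace LayerClock

open IncrementingSystem

variable {V A : Type*} {P : LayerClock V A} {G : SimpleGraph V} {γ γ' : P.Config}

theorem eq_NA_of_guard (h : WU G γ) {p : V} {a : Action} (ha : Guard G γ p a) : a = .NA := by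
  have h1 := wu_iff_forall_locallyCorrect.1 h.1 p
  have h2 := wu_iff_forall_locallyCorrect.1 h.2 p
  cases a with
  | NA => rfl
  | CA₁ => exact (h1.not_convergenceStep ha).elim
  | CA₂ => exact (h2.not_convergenceStep ha).elim
  | RA₁ => exact (ha.1 h1).elim
  | RA₂ => exact (ha.1 h2).elim

theorem slaveBlock_r₁ (γ : P.Config) (p : V) : (slaveBlock G γ p p).r₁ = (γ p).r₁ := by
  unfold slaveBlock
  dsimp only
  split_ifs <;> simp [setApp, incr₂]

theorem slaveBlock_r₂ (γ : P.Config) (p : V) :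
    (slaveBlock G γ p p).r₂ = (γ p).r₂ ∨
      (NormalStep G (reg₂ γ) p ∧ (slaveBlock G γ p p).r₂ = P.S₂.φ (γ p).r₂) := by
  unfold slaveBlock
  dsimp only
  split_ifs with h1 h2
  · exact .inr ⟨h1.1, by simp [setApp, incr₂]⟩
  · simp [setApp]
  · simp

theorem exec_NA_r₁ (γ : P.Config) (p : V) : (exec G γ p .NA).r₁ = P.S₁.φ (γ p).r₁ := by
  simp only [exec, normalAction, incr₁, Function.update_self]
  split_ifs <;> simp [setApp, slaveBlock_r₁]

theorem exec_NA_r₂ (γ : P.Config) (p : V) :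
    (exec G γ p .NA).r₂ = (γ p).r₂ ∨
      (NormalStep G (reg₂ γ) p ∧ (exec G γ p .NA).r₂ = P.S₂.φ (γ p).r₂) := by
  simp only [exec, normalAction, incr₁, Function.update_self]
  split_ifs
  · simpa [setApp] using slaveBlock_r₂ γ p
  · simp [setApp]

theorem Step.eq_or_normalStep (h : WU G γ) (hs : Step G γ γ') :
    (∀ p, reg₁ γ' p = reg₁ γ p ∨
      (NormalStep G (reg₁ γ) p ∧ reg₁ γ' p = P.S₁.φ (reg₁ γ p))) ∧
    (∀ p, reg₂ γ' p = reg₂ γ p ∨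
      (NormalStep G (reg₂ γ) p ∧ reg₂ γ' p = P.S₂.φ (reg₂ γ p))) := by
  obtain ⟨m, -, hm⟩ := hs
  rw [← forall_and]
  intro p
  have hp := hm p
  cases hmp : m p with
  | none =>
    rw [hmp] at hp
    simp [reg₁, reg₂, show γ' p = γ p from hp]
  | some a =>
    rw [hmp] at hp
    obtain ⟨hg, he⟩ := hp
    obtain rfl := eq_NA_of_guard h hg
    simp only [reg₁, reg₂, he]
    exact ⟨.inr ⟨hg.1, exec_NA_r₁ γ p⟩, exec_NA_r₂ γ p⟩

theorem Step.exists_ne (hK : 2 ≤ P.S₁.K) (h : WU G γ) (hs : Step G γ γ') :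
    ∃ p, reg₁ γ' p ≠ reg₁ γ p := by
  obtain ⟨m, ⟨p, hp⟩, hm⟩ := hs
  obtain ⟨a, ha⟩ := Option.ne_none_iff_exists'.1 hp
  have := hm p
  rw [ha] at this
  obtain ⟨hg, he⟩ := this
  obtain rfl := eq_NA_of_guard h hg
  refine ⟨p, ?_⟩
  simp only [reg₁, he, exec_NA_r₁]
  exact φ_ne_self hK _

theorem WU.step (h : WU G γ) (hs : Step G γ γ') : WU G γ' :=
  ⟨h.1.step (hs.eq_or_normalStep h).1, h.2.step (hs.eq_or_normalStep h).2⟩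

theorem WU.exists_enabled [Finite V] (hG : G.Connected)
    (hK : cyclomaticCharacteristic G < P.S₁.K) (h : WU G γ) : ∃ p, Enabled G γ p := by
  obtain ⟨H, hH⟩ := h.1.exists_isLift hG hK
  have := hG.nonempty
  obtain ⟨p, hp⟩ := Finite.exists_min H
  exact ⟨p, .NA, hH.normalStep (fun q => (h.1 q).1) fun q _ => hp q,
    wu_iff_forall_locallyCorrect.1 h.2 p⟩

variable {γ : ℕ → P.Config} {L : ℕ∞}

theorem IsMaximalExecution.wu_of_le (hγ : IsMaximalExecution G γ L) {T t : ℕ}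
    (hWU : WU G (γ T)) (hTt : T ≤ t) (ht : (t : ℕ∞) ≤ L) : WU G (γ t) := by
  induction t, hTt using Nat.le_induction with
  | base => exact hWU
  | succ t _ ih =>
    have hlt : (t : ℕ∞) < L := lt_of_lt_of_le (by exact_mod_cast t.lt_succ_self) ht
    exact (ih hlt.le).step (hγ.step t hlt)

/-- An execution that reaches a stabilized configuration does not terminate. -/
theorem IsMaximalExecution.eq_top [Finite V] (hγ : IsMaximalExecution G γ L) (hG : G.Connected)
    (hK : cyclomaticCharacteristic G < P.S₁.K) {T : ℕ} (hT : (T : ℕ∞) ≤ L)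
    (hWU : WU G (γ T)) : L = ⊤ := by
  by_contra hL
  obtain ⟨N, rfl⟩ := ENat.ne_top_iff_exists.1 hL
  obtain ⟨p, hp⟩ := (hγ.wu_of_le hWU (by exact_mod_cast hT) le_rfl).exists_enabled hG hK
  exact hγ.terminal N rfl p hp

/-- After a stabilized configuration of an infinite execution, every process increments its
master clock. -/
theorem IsMaximalExecution.exists_increments₁ [Finite V] (hγ : IsMaximalExecution G γ ⊤)
    (hG : G.Connected) (hK : cyclomaticCharacteristic G < P.S₁.K) {T : ℕ}
    (hWU : WU G (γ T)) (p : V) : ∃ t, T ≤ t ∧ Increments₁ γ t p := by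
  classical
  have := Fintype.ofFinite V
  have h3 : 3 ≤ P.S₁.K := (two_le_cyclomaticCharacteristic G).trans_lt hK
  by_contra! hno
  obtain ⟨H₀, hH₀⟩ := hWU.1.exists_isLift hG hK
  have key : ∀ n : ℕ, ∃ H, IsLift G (reg₁ (γ (T + n))) H ∧ H p = H₀ p ∧
      ∑ q, H₀ q + n ≤ ∑ q, H q := by
    intro n
    induction n with
    | zero => exact ⟨H₀, hH₀, rfl, by simp⟩
    | succ n ih =>
      obtain ⟨H, hH, hp, hsum⟩ := ih
      have hW := hγ.wu_of_le hWU (Nat.le_add_right T n) le_top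
      have hs := hγ.step (T + n) (ENat.natCast_lt_top _)
      have hr := (hs.eq_or_normalStep hW).1
      obtain ⟨q, hq⟩ := hs.exists_ne (by omega) hW
      refine ⟨_, hH.step h3 hr, ?_, ?_⟩
      · have hpp : reg₁ (γ (T + n + 1)) p = reg₁ (γ (T + n)) p := by
          by_contra hne
          exact hno (T + n) (Nat.le_add_right T n) ⟨fun h => hne h.symm, ((hr p).resolve_left hne).2⟩
        simp [← add_assoc, hpp, hp]
      · have h1 : (1 : ℤ) ≤
            ∑ q, if reg₁ (γ (T + n + 1)) q = reg₁ (γ (T + n)) q then (0 : ℤ) else 1 := by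
          refine le_trans ?_ (Finset.single_le_sum (fun i _ => ?_) (Finset.mem_univ q))
          · rw [if_neg hq]
          · split_ifs <;> simp
        rw [Finset.sum_add_distrib, ← add_assoc]
        push_cast
        linarith
  let B : ℤ := ∑ q, (H₀ p + ((hG q p).some.length : ℤ))
  obtain ⟨H, hH, hp, hsum⟩ := key (B - ∑ q, H₀ q + 1).toNat
  have hB : ∑ q, H q ≤ B := Finset.sum_le_sum fun q _ => hp ▸ hH.le_add_length (hG q p).some
  have := Int.self_le_toNat (B - ∑ q, H₀ q + 1)
  linarith

end LayerClock

end WaveletClock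

theorem mainTheorem4 {V A : Type*} [Finite V] (G : SimpleGraph V) (hG : G.Connected)
    (P : WaveletClock.LayerClock V A)
    (hK : WaveletClock.cyclomaticCharacteristic G < P.S₁.K)
    (γ : ℕ → P.Config) (L : ℕ∞)
    (hγ : WaveletClock.LayerClock.IsMaximalExecution G γ L)
    (T : ℕ) (hT : (T : ℕ∞) ≤ L) (hWU : WaveletClock.LayerClock.WU G (γ T)) (p : V) :
    {t : ℕ | T ≤ t ∧ (t : ℕ∞) < L ∧ WaveletClock.LayerClock.Increments₁ γ t p}.Infinite := by
  obtain rfl := hγ.eq_top hG hK hT hWU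
  refine Set.infinite_of_forall_exists_gt fun a => ?_
  obtain ⟨t, ht, hinc⟩ := hγ.exists_increments₁ hG hK
    (hγ.wu_of_le hWU (le_max_left T (a + 1)) le_top) p
  exact ⟨t, ⟨(le_max_left _ _).trans ht, ENat.natCast_lt_top t, hinc⟩, (le_max_right _ _).trans ht⟩
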